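/- Let $n\ge 2$, let $\Delta=\{p\in(0,1)^n:\sum_i p_i=1\}$ be the open unit simplex and $\overline\Delta$ its closure in $\mathbb R^n$. For $p,q\in\overline\Delta$ let $H(q\mid p)=\sum_{i=1}^n q_i\log(q_i/p_i)\in[0,\infty]$ be the relative entropy. Let $U\subset\Delta$ and $V\subset\overline\Delta$, and let $\mathcal P$ and $\mathcal Q$ be Borel probability measures on $\overline\Delta$ supported on $U$ and $V$ respectively (that is, the complements of $U$ and $V$ are null sets of $\mathcal P$ and $\mathcal Q$). Suppose that $$\gamma:=\sup_{\pi\in V,\ \mu\in U}H(\pi\mid\mu)<\infty .$$ Consider the optimal transport problem $$\inf_{\mathcal R\in\Pi(\mathcal P,\mathcal Q)}\int -H(q\mid p)\,\mathcal R(dp,dq),$$ where $\Pi(\mathcal P,\mathcal Q)$ is the set of probability measures on $\overline\Delta\times\overline\Delta$ with marginals $\mathcal P$ and $\mathcal Q$; a minimizer is called an optimal coupling. Then the value of this problem is finite. Moreover, there exists a concave function $\Phi:\Delta\to(0,\infty)$ such that: (i) every optimal coupling $\mathcal R$ is concentrated on the set $$\Big\{(p,q)\in U\times\overline\Delta:\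 \Big(\frac{q_i}{p_i}-\frac1n\sum_{j=1}^n\frac{q_j}{p_j}\Big)_{1\le i\le n}\in\partial\log\Phi(p)\Big\},$$ where $\partial\log\Phi(p)$ is the set of all $\xi\in\mathbb R^n$ with $\sum_i\xi_i=0$ and $\log\Phi(p)+\langle\xi,r-p\rangle\ge\log\Phi(r)$ for all $r\in\Delta$; (ii) $\Phi(q)/\Phi(p)\le e^{\gamma}$ for all $p,q\in U$; thus $\log\Phi$ is bounded on $U$. -/

import Mathlib

open MeasureTheory

/-! ### The Monge-Kantorovich problem with an extended-real cost -/

/-- The couplings of `P` and `Q`: the probability measures on the product space with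
marginals `P` and `Q`. -/
def couplings {X Y : Type*} [MeasurableSpace X] [MeasurableSpace Y]
    (P : Measure X) (Q : Measure Y) : Set (Measure (X × Y)) :=
  {R | IsProbabilityMeasure R ∧ R.map Prod.fst = P ∧ R.map Prod.snd = Q}

/-- The expectation of an extended-real function: the integral of its positive part minus
the integral of its negative part. -/
noncomputable def expectation {Ω : Type*} [MeasurableSpace Ω]
    (R : Measure Ω) (f : Ω → EReal) : EReal :=
  ((∫⁻ ω, (f ω).toENNReal ∂ R : ENNReal) : EReal) -
    ((∫⁻ ω, (-(f ω)).toENNReal ∂ R : ENNReal) : EReal)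

/-- The value of the transport problem with cost `c`: the infimum of the expected cost over
all couplings. -/
noncomputable def transportValue {X Y : Type*} [MeasurableSpace X] [MeasurableSpace Y]
    (c : X → Y → EReal) (P : Measure X) (Q : Measure Y) : EReal :=
  ⨅ R ∈ couplings P Q, expectation R (fun z => c z.1 z.2)

/-- `R` is an optimal coupling: a coupling whose expected cost attains the value. -/
def IsOptimalCoupling {X Y : Type*} [MeasurableSpace X] [MeasurableSpace Y]
    (c : X → Y → EReal) (P : Measure X) (Q : Measure Y) (R : Measure (X × Y)) : Prop :=
  R ∈ couplings P Q ∧ expectation R (fun z => c z.1 z.2) = transportValue c P Q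

/-! ### The unit simplex and relative entropy -/

/-- The open unit simplex. The closed one is `stdSimplex ℝ (Fin n)`. -/
def openSimplex (n : ℕ) : Set (Fin n → ℝ) :=
  {p | (∀ i, 0 < p i) ∧ ∑ i, p i = 1}

open Classical in
/-- The relative entropy `H(q | p) = ∑ i, q i * log (q i / p i)` of points of the closed
simplex, with `0 * log (0 / t) = 0` for `t ≥ 0` and `s * log (s / 0) = ∞` for `s > 0`. -/
noncomputable def relativeEntropy {n : ℕ} (q p : stdSimplex ℝ (Fin n)) : EReal :=
  if ∃ i, p.1 i = 0 ∧ q.1 i ≠ 0 then ⊤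
  else ((∑ i, q.1 i * Real.log (q.1 i / p.1 i) : ℝ) : EReal)

/-- The negative relative entropy cost. -/
noncomputable def entropyCost {n : ℕ} (p q : stdSimplex ℝ (Fin n)) : EReal :=
  -relativeEntropy q p

/-- The superdifferential at `p` of a function `f` on the open simplex: the tangent vectors
`ξ` (their coordinates sum to `0`) with `f p + ⟨ξ, q - p⟩ ≥ f q` for all `q` in the open
simplex. -/
def superdifferential {n : ℕ} (f : (Fin n → ℝ) → ℝ) (p : Fin n → ℝ) : Set (Fin n → ℝ) :=
  {ξ | ∑ i, ξ i = 0 ∧ ∀ q ∈ openSimplex n, f q ≤ f p + ∑ i, ξ i * (q i - p i)}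

/-! On `U × V` the cost lies in `[-γ, 0]`, so the value is finite. A minimiser maximises the mean of
`H(q | p)`, and exchanging small equal masses near points of the supports of optimal couplings
cannot increase that mean. Hence the part `Γ` in `U × V` of the union of these supports is
cyclically monotone: `∑ k, (H(q_k | p_k) - H(q_k | p_{σ k})) ≥ 0`.

The terms `q log q` cancel, and the summand is `entropyGap`, the value `∑ i, q i * log (r i / p i)`
at `r = p_{σ k}`. Read as edge weights on `Γ`, these gaps have no negative cycle, so shortest-path
lengths give a potential `u`. Put `φ r = inf_z (u z + entropyGap (q z) (p z) r)` and `Φ = exp φ`.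
Each exponential is a multiple of a weighted geometric mean of `r`, hence concave, and so is the
infimum `Φ`.

At `(p, q) ∈ Γ` the infimum is attained by that pair itself, so `φ r ≤ φ p + ∑ i, q i * log (r i / p
i)`. By `log t ≤ t - 1`, `q / p` is a supergradient; centring it does not matter against tangent
vectors. Between points of `U` each gap is a difference of two entropies in `[0, γ]`, which gives
(ii). -/

/-! ### Potentials of weights without negative cycles -/

/-- `PathWeight w a b t`: there is a path of total weight `t` from `a` to `b`. -/
def PathWeight {Z : Type*} (w : Z → Z → ℝ) (a b : Z) (t : ℝ) : Prop :=
  ∃ (m : ℕ) (f : ℕ → Z), f 0 = a ∧ f m = b ∧ t = ∑ k ∈ Finset.range m, w (f k) (f (k + 1))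

theorem PathWeight.snoc {Z : Type*} {w : Z → Z → ℝ} {a b : Z} {t : ℝ}
    (h : PathWeight w a b t) (c : Z) : PathWeight w a c (t + w b c) := by
  obtain ⟨m, f, h0, hm, rfl⟩ := h
  refine ⟨m + 1, fun k => if k ≤ m then f k else c, by simp [h0], by simp, ?_⟩
  rw [Finset.sum_range_succ]
  congr 1
  · refine Finset.sum_congr rfl fun k hk => ?_
    have := Finset.mem_range.1 hk
    simp [this.le, Nat.succ_le_of_lt this]
  · simp [hm]

/-- Weights all of whose cycles are nonnegative have a potential. -/
theorem exists_potential {Z : Type*} [Nonempty Z] (w : Z → Z → ℝ)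
    (hw : ∀ (m : ℕ) (z : Fin (m + 1) → Z), 0 ≤ ∑ k, w (z k) (z (finRotate (m + 1) k))) :
    ∃ u : Z → ℝ, ∀ a b, u b ≤ u a + w a b := by
  classical
  let o : Z := Classical.arbitrary Z
  have hnil : PathWeight w o o 0 := ⟨0, fun _ => o, rfl, rfl, by simp⟩
  have hne : ∀ a, {t | PathWeight w o a t}.Nonempty := fun a => ⟨_, hnil.snoc a⟩
  have hbdd : ∀ a, BddBelow {t | PathWeight w o a t} := by
    intro a
    -- The edge from `a` back to `o` closes any path from `o` to `a` into a cycle.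
    refine ⟨-w a o, ?_⟩
    rintro t ⟨m, f, h0, hm, rfl⟩
    have h := hw m fun k => f k
    rw [Fin.sum_univ_castSucc] at h
    simp only [finRotate_last] at h
    have : ∀ k : Fin m, ((finRotate (m + 1) k.castSucc : Fin (m + 1)) : ℕ) = k + 1 := by
      intro k
      rw [coe_finRotate_of_ne_last (by simp [Fin.ext_iff, k.2.ne])]
      simp
    simp only [this, Fin.val_castSucc, Fin.val_last, Fin.val_zero, h0, hm] at h
    rw [Fin.sum_univ_eq_sum_range (fun k => w (f k) (f (k + 1)))] at h
    linarith
  refine ⟨fun a => sInf {t | PathWeight w o a t}, fun a b => ?_⟩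
  rw [← sub_le_iff_le_add]
  refine le_csInf (hne a) fun t ht => ?_
  rw [sub_le_iff_le_add]
  exact csInf_le (hbdd b) (PathWeight.snoc ht b)

/-! ### Cyclical monotonicity of optimal couplings -/

section Perturbation

variable {X Y : Type*} [MeasurableSpace X] [MeasurableSpace Y]

/-- Exchanging mass between rectangles charged by couplings that maximise `∫ f` does not
increase `f`. -/
theorem sum_le_sum_of_maximal {P : Measure X} {Q : Measure Y} [IsProbabilityMeasure P]
    {f : X × Y → ℝ} (hf : Measurable f) {C : ℝ} (hC : ∀ z, |f z| ≤ C)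
    {ι : Type*} [Fintype ι] [Nonempty ι] (σ : Equiv.Perm ι) {R : ι → Measure (X × Y)}
    (hR : ∀ k, R k ∈ couplings P Q)
    (hmax : ∀ k, ∀ R' ∈ couplings P Q, ∫ z, f z ∂ R' ≤ ∫ z, f z ∂ (R k))
    {S : ι → Set X} {T : ι → Set Y} (hS : ∀ k, MeasurableSet (S k))
    (hT : ∀ k, MeasurableSet (T k)) (hpos : ∀ k, R k (S k ×ˢ T k) ≠ 0)
    {a b : ι → ℝ} (ha : ∀ k, ∀ z ∈ S k ×ˢ T k, f z ≤ a k)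
    (hb : ∀ k, ∀ x ∈ S (σ k), ∀ y ∈ T k, b k ≤ f (x, y)) :
    ∑ k, b k ≤ ∑ k, a k := by
  classical
  have hprob : ∀ k, IsProbabilityMeasure (R k) := fun k => (hR k).1
  have hint : ∀ (μ : Measure (X × Y)) [IsFiniteMeasure μ], Integrable f μ := fun μ _ =>
    Integrable.of_bound hf.aestronglyMeasurable C (.of_forall hC)
  set A : ι → Set (X × Y) := fun k => S k ×ˢ T k
  have hAm : ∀ k, MeasurableSet (A k) := fun k => (hS k).prod (hT k)
  set N : ι → Measure (X × Y) := fun k => ProbabilityTheory.cond (R k) (A k) with hN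
  have hNprob : ∀ k, IsProbabilityMeasure (N k) := fun k =>
    ProbabilityTheory.cond_isProbabilityMeasure (hpos k)
  have hNae : ∀ k, ∀ᵐ z ∂ (N k), z ∈ A k := fun k =>
    ProbabilityTheory.ae_cond_mem (hAm k)
  -- The least of the masses can be removed from every rectangle.
  obtain ⟨k₀, hk₀⟩ := Finite.exists_min fun k => R k (A k)
  set δ : ENNReal := R k₀ (A k₀) with hδ
  have hδ0 : δ ≠ 0 := hpos k₀
  have hδt : δ ≠ ⊤ := measure_ne_top _ _
  set D : ι → Measure (X × Y) := fun k =>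
    (R k).restrict (A k)ᶜ + (R k (A k) - δ) • N k with hD
  have hDR : ∀ k, D k + δ • N k = R k := by
    intro k
    rw [hD]
    simp only
    rw [add_assoc, ← add_smul, tsub_add_cancel_of_le (hk₀ k), hN]
    simp only [ProbabilityTheory.cond]
    rw [smul_smul, ENNReal.mul_inv_cancel (hpos k) (measure_ne_top _ _), one_smul, add_comm]
    exact Measure.restrict_add_restrict_compl (hAm k)
  have hDfin : ∀ k, IsFiniteMeasure (D k) := fun k =>
    isFiniteMeasure_of_le (R k) ((hDR k) ▸ Measure.le_add_right le_rfl)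
  set μ : ι → Measure X := fun k => (N k).map Prod.fst with hμ
  set ν : ι → Measure Y := fun k => (N k).map Prod.snd with hν
  have hμp : ∀ k, IsProbabilityMeasure (μ k) := fun k =>
    Measure.isProbabilityMeasure_map measurable_fst.aemeasurable
  have hνp : ∀ k, IsProbabilityMeasure (ν k) := fun k =>
    Measure.isProbabilityMeasure_map measurable_snd.aemeasurable
  -- Second coordinates from rectangle `k` are re-paired, independently, with first coordinates from
  -- rectangle `σ k`.
  set M : ι → Measure (X × Y) := fun k => (μ (σ k)).prod (ν k) with hM
  have hMp : ∀ k, IsProbabilityMeasure (M k) := fun k => by rw [hM]; infer_instance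
  have hMfin : ∀ k, IsFiniteMeasure (δ • M k) := fun k => Measure.smul_finite _ hδt
  have hNfin : ∀ k, IsFiniteMeasure (δ • N k) := fun k => Measure.smul_finite _ hδt
  set c : ENNReal := (Fintype.card ι : ENNReal) with hc
  have hc0 : c ≠ 0 := by simp [hc]
  have hct : c ≠ ⊤ := by simp [hc]
  -- A single `D k + δ • M k` may have the wrong first marginal; averaging over `k` repairs it
  -- because `σ` is a permutation.
  set R' : Measure (X × Y) := c⁻¹ • ∑ k, (D k + δ • M k) with hR'
  have hfst : R'.map Prod.fst = P := by
    ext s hs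
    have h1 : ∀ k, M k (Prod.fst ⁻¹' s) = N (σ k) (Prod.fst ⁻¹' s) := by
      intro k
      have h : (M k).map Prod.fst = (N (σ k)).map Prod.fst := Measure.fst_prod
      rw [← Measure.map_apply measurable_fst hs, h, Measure.map_apply measurable_fst hs]
    have h2 : ∀ k, D k (Prod.fst ⁻¹' s) + δ * N k (Prod.fst ⁻¹' s) = P s := by
      intro k
      rw [← (hR k).2.1, Measure.map_apply measurable_fst hs]
      conv_rhs => rw [← hDR k]
      simp
    rw [Measure.map_apply measurable_fst hs, hR']
    simp only [Measure.smul_apply, Measure.finsetSum_apply, Measure.add_apply, smul_eq_mul, h1]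
    rw [Finset.sum_add_distrib, Equiv.sum_comp σ fun k => δ * N k (Prod.fst ⁻¹' s),
      ← Finset.sum_add_distrib]
    simp only [h2, Finset.sum_const, Finset.card_univ, nsmul_eq_mul]
    rw [← mul_assoc, ENNReal.inv_mul_cancel hc0 hct, one_mul]
  have hsnd : R'.map Prod.snd = Q := by
    ext s hs
    have h1 : ∀ k, M k (Prod.snd ⁻¹' s) = N k (Prod.snd ⁻¹' s) := by
      intro k
      have h : (M k).map Prod.snd = (N k).map Prod.snd := Measure.snd_prod
      rw [← Measure.map_apply measurable_snd hs, h, Measure.map_apply measurable_snd hs]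
    have h2 : ∀ k, D k (Prod.snd ⁻¹' s) + δ * N k (Prod.snd ⁻¹' s) = Q s := by
      intro k
      rw [← (hR k).2.2, Measure.map_apply measurable_snd hs]
      conv_rhs => rw [← hDR k]
      simp
    rw [Measure.map_apply measurable_snd hs, hR']
    simp only [Measure.smul_apply, Measure.finsetSum_apply, Measure.add_apply, smul_eq_mul, h1]
    simp only [h2, Finset.sum_const, Finset.card_univ, nsmul_eq_mul]
    rw [← mul_assoc, ENNReal.inv_mul_cancel hc0 hct, one_mul]
  have hR'p : IsProbabilityMeasure R' := ⟨by
    rw [← Set.preimage_univ (f := Prod.fst), ← Measure.map_apply measurable_fst .univ, hfst,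
      measure_univ]⟩
  have hle : ∑ _k : ι, ∫ z, f z ∂ R' ≤ ∑ k, ∫ z, f z ∂ (R k) :=
    Finset.sum_le_sum fun k _ => hmax k R' ⟨hR'p, hfst, hsnd⟩
  have hR'int : ∑ _k : ι, ∫ z, f z ∂ R' =
      ∑ k, (∫ z, f z ∂ (D k) + δ.toReal * ∫ z, f z ∂ (M k)) := by
    rw [Finset.sum_const, Finset.card_univ, hR', integral_smul_measure,
      integral_finsetSum_measure fun k _ => hint _]
    have : (Fintype.card ι : ℝ) ≠ 0 := by simp
    simp only [hc, ENNReal.toReal_inv, ENNReal.toReal_natCast, nsmul_eq_mul, smul_eq_mul]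
    rw [← mul_assoc, mul_inv_cancel₀ this, one_mul]
    refine Finset.sum_congr rfl fun k _ => ?_
    rw [integral_add_measure (hint _) (hint _), integral_smul_measure, smul_eq_mul]
  have hRint : ∀ k, ∫ z, f z ∂ (R k) = ∫ z, f z ∂ (D k) + δ.toReal * ∫ z, f z ∂ (N k) := by
    intro k
    conv_lhs => rw [← hDR k]
    rw [integral_add_measure (hint _) (hint _), integral_smul_measure, smul_eq_mul]
  rw [hR'int, Finset.sum_congr rfl fun k _ => hRint k, Finset.sum_add_distrib,
    Finset.sum_add_distrib, ← Finset.mul_sum, ← Finset.mul_sum] at hle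
  have hMN : ∑ k, ∫ z, f z ∂ (M k) ≤ ∑ k, ∫ z, f z ∂ (N k) :=
    le_of_mul_le_mul_left (by linarith) (ENNReal.toReal_pos hδ0 hδt)
  calc ∑ k, b k ≤ ∑ k, ∫ z, f z ∂ (M k) := by
        refine Finset.sum_le_sum fun k _ => ?_
        have hx : ∀ᵐ x ∂ (μ (σ k)), x ∈ S (σ k) := by
          rw [hμ]
          refine (ae_map_iff measurable_fst.aemeasurable (hS _)).2 ?_
          filter_upwards [hNae (σ k)] with z hz using hz.1
        have hy : ∀ᵐ y ∂ (ν k), y ∈ T k := by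
          rw [hν]
          refine (ae_map_iff measurable_snd.aemeasurable (hT _)).2 ?_
          filter_upwards [hNae k] with z hz using hz.2
        have hz : ∀ᵐ z ∂ (M k), b k ≤ f z := by
          filter_upwards [Measure.quasiMeasurePreserving_fst.ae hx,
            Measure.quasiMeasurePreserving_snd.ae hy] with z h1 h2 using hb k _ h1 _ h2
        simpa using integral_mono_ae (integrable_const (b k)) (hint (M k)) hz
    _ ≤ ∑ k, ∫ z, f z ∂ (N k) := hMN
    _ ≤ ∑ k, a k := by
        refine Finset.sum_le_sum fun k _ => ?_
        have hz : ∀ᵐ z ∂ (N k), f z ≤ a k := by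
          filter_upwards [hNae k] with z hz using ha k z hz
        simpa using integral_mono_ae (hint (N k)) (integrable_const (a k)) hz

variable [TopologicalSpace X] [TopologicalSpace Y] [OpensMeasurableSpace X]
  [OpensMeasurableSpace Y]

/-- The supports of all couplings that maximise `∫ f` are jointly cyclically monotone. -/
theorem cyclicallyMonotone_of_maximal {P : Measure X} {Q : Measure Y} [IsProbabilityMeasure P]
    {f : X × Y → ℝ} (hf : Measurable f) {C : ℝ} (hC : ∀ z, |f z| ≤ C)
    {ι : Type*} [Fintype ι] [Nonempty ι] (σ : Equiv.Perm ι) {R : ι → Measure (X × Y)}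
    (hR : ∀ k, R k ∈ couplings P Q)
    (hmax : ∀ k, ∀ R' ∈ couplings P Q, ∫ z, f z ∂ R' ≤ ∫ z, f z ∂ (R k))
    {z : ι → X × Y} (hz : ∀ k, z k ∈ (R k).support)
    (hcont : ∀ k l, ContinuousAt f ((z k).1, (z l).2)) :
    ∑ k, f ((z (σ k)).1, (z k).2) ≤ ∑ k, f (z k) := by
  classical
  refine le_of_forall_pos_le_add fun ε hε => ?_
  -- Each index loses `η` on both sides of the inequality, `ε` in total.
  set η : ℝ := ε / (2 * Fintype.card ι) with hη
  have hcard : (0 : ℝ) < Fintype.card ι := by simp [Fintype.card_pos]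
  have hη0 : 0 < η := by positivity
  have hnear : ∀ k l, ∃ S : Set X, ∃ T : Set Y, IsOpen S ∧ (z k).1 ∈ S ∧ IsOpen T ∧
      (z l).2 ∈ T ∧ ∀ x ∈ S, ∀ y ∈ T, |f (x, y) - f ((z k).1, (z l).2)| < η := by
    intro k l
    have h := hcont k l (Metric.ball_mem_nhds _ hη0)
    obtain ⟨S, T, hS, hxS, hT, hyT, hST⟩ := mem_nhds_prod_iff'.1 h
    exact ⟨S, T, hS, hxS, hT, hyT, fun x hx y hy => by
      simpa [Real.dist_eq] using hST (Set.mk_mem_prod hx hy)⟩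
  choose S T hSo hSz hTo hTz hST using hnear
  have hSo' : ∀ k, IsOpen (⋂ l, S k l) := fun k => isOpen_iInter_of_finite fun l => hSo k l
  have hTo' : ∀ k, IsOpen (⋂ l, T l k) := fun k => isOpen_iInter_of_finite fun l => hTo l k
  have key := sum_le_sum_of_maximal hf hC σ hR hmax
    (S := fun k => ⋂ l, S k l) (T := fun k => ⋂ l, T l k)
    (a := fun k => f (z k) + η) (b := fun k => f ((z (σ k)).1, (z k).2) - η)
    (fun k => (hSo' k).measurableSet) (fun k => (hTo' k).measurableSet)
    (fun k => by
      refine ((Measure.mem_support_iff_forall _).1 (hz k) _ ?_).ne'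
      exact prod_mem_nhds ((hSo' k).mem_nhds (Set.mem_iInter.2 fun l => hSz k l))
        ((hTo' k).mem_nhds (Set.mem_iInter.2 fun l => hTz l k)))
    (fun k p hp => by
      have := hST k k p.1 (Set.mem_iInter.1 hp.1 k) p.2 (Set.mem_iInter.1 hp.2 k)
      rw [abs_lt] at this
      linarith [this.2])
    (fun k x hx y hy => by
      have := hST (σ k) k x (Set.mem_iInter.1 hx k) y (Set.mem_iInter.1 hy (σ k))
      rw [abs_lt] at this
      linarith [this.1])
  simp only [Finset.sum_sub_distrib, Finset.sum_add_distrib, Finset.sum_const, Finset.card_univ,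
    nsmul_eq_mul] at key
  have : Fintype.card ι * η = ε / 2 := by rw [hη]; field_simp
  linarith

end Perturbation

/-! ### Relative entropy at interior points -/

section Entropy

variable {n : ℕ}

/-- The change of the relative entropy `H(q | ·)` from `r` to `p`. -/
noncomputable def entropyGap (q : stdSimplex ℝ (Fin n)) (p r : Fin n → ℝ) : ℝ :=
  ∑ i, q.1 i * (Real.log (r i) - Real.log (p i))

/-- The real-valued relative entropy `H(z.2 | z.1)`. -/
noncomputable def klSum (z : stdSimplex ℝ (Fin n) × stdSimplex ℝ (Fin n)) : ℝ :=
  ∑ i, z.2.1 i * Real.log (z.2.1 i / z.1.1 i)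

theorem relativeEntropy_eq_klSum {p q : stdSimplex ℝ (Fin n)} (hp : p.1 ∈ openSimplex n) :
    relativeEntropy q p = (klSum (p, q) : EReal) := by
  rw [relativeEntropy, if_neg]
  · rfl
  · rintro ⟨i, hi, -⟩
    exact (hp.1 i).ne' hi

/-- Gibbs' inequality, from the termwise bound `q log (q / p) ≥ q - p`. -/
theorem klSum_nonneg {p q : stdSimplex ℝ (Fin n)} (hp : p.1 ∈ openSimplex n) :
    0 ≤ klSum (p, q) := by
  have h : ∑ i, (q.1 i - p.1 i) ≤ klSum (p, q) := by
    refine Finset.sum_le_sum fun i _ => ?_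
    rcases (q.2.1 i).eq_or_lt with h0 | h0
    · have := (hp.1 i).le
      simp only [← h0]
      linarith
    · have h1 := Real.one_sub_inv_le_log_of_pos (div_pos h0 (hp.1 i))
      have h2 := mul_le_mul_of_nonneg_left h1 h0.le
      rw [inv_div, mul_sub, mul_one, mul_div_cancel₀ _ h0.ne'] at h2
      exact h2
  rwa [Finset.sum_sub_distrib, q.2.2, p.2.2, sub_self] at h

theorem klSum_sub_klSum {p r q : stdSimplex ℝ (Fin n)} (hp : p.1 ∈ openSimplex n)
    (hr : r.1 ∈ openSimplex n) : klSum (p, q) - klSum (r, q) = entropyGap q p.1 r.1 := by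
  rw [klSum, klSum, entropyGap, ← Finset.sum_sub_distrib]
  refine Finset.sum_congr rfl fun i _ => ?_
  rcases (q.2.1 i).eq_or_lt with h0 | h0
  · simp [← h0]
  · simp only
    rw [Real.log_div h0.ne' (hp.1 i).ne', Real.log_div h0.ne' (hr.1 i).ne']
    ring

theorem measurable_klSum : Measurable (klSum (n := n)) := by
  unfold klSum
  have h1 : ∀ i, Measurable fun z : stdSimplex ℝ (Fin n) × stdSimplex ℝ (Fin n) => z.1.1 i :=
    fun i => (measurable_pi_apply i).comp (measurable_subtype_coe.comp measurable_fst)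
  have h2 : ∀ i, Measurable fun z : stdSimplex ℝ (Fin n) × stdSimplex ℝ (Fin n) => z.2.1 i :=
    fun i => (measurable_pi_apply i).comp (measurable_subtype_coe.comp measurable_snd)
  exact Finset.measurable_sum _ fun i _ => (h2 i).mul ((h2 i).div (h1 i)).log

theorem continuousAt_klSum {p q : stdSimplex ℝ (Fin n)} (hp : p.1 ∈ openSimplex n) :
    ContinuousAt klSum (p, q) := by
  have h1 : ∀ i, Continuous fun z : stdSimplex ℝ (Fin n) × stdSimplex ℝ (Fin n) => z.1.1 i :=
    fun i => (continuous_apply i).comp (continuous_subtype_val.comp continuous_fst)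
  have h2 : ∀ i, Continuous fun z : stdSimplex ℝ (Fin n) × stdSimplex ℝ (Fin n) => z.2.1 i :=
    fun i => (continuous_apply i).comp (continuous_subtype_val.comp continuous_snd)
  -- Splitting the logarithm isolates `x log x`, which is continuous even at `0`, so `q` may lie on
  -- the boundary.
  have hc : ContinuousAt (fun z : stdSimplex ℝ (Fin n) × stdSimplex ℝ (Fin n) =>
      ∑ i, (z.2.1 i * Real.log (z.2.1 i) - z.2.1 i * Real.log (z.1.1 i))) (p, q) := by
    refine tendsto_finsetSum _ fun i _ => ContinuousAt.sub ?_ ?_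
    · exact (Real.continuous_mul_log.comp (h2 i)).continuousAt
    · exact (h2 i).continuousAt.mul ((h1 i).continuousAt.log (hp.1 i).ne')
  refine hc.congr ?_
  have hev : ∀ᶠ z : stdSimplex ℝ (Fin n) × stdSimplex ℝ (Fin n) in nhds (p, q),
      ∀ i, 0 < z.1.1 i :=
    Filter.eventually_all.2 fun i => (h1 i).continuousAt.eventually (lt_mem_nhds (hp.1 i))
  filter_upwards [hev] with z hz
  refine Finset.sum_congr rfl fun i _ => ?_
  rcases (z.2.2.1 i).eq_or_lt with h0 | h0
  · simp [← h0]
  · rw [Real.log_div h0.ne' (hz i).ne']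
    ring

theorem convex_openSimplex : Convex ℝ (openSimplex n) := by
  intro x hx y hy a b ha hb hab
  refine ⟨fun i => ?_, ?_⟩
  · rcases ha.eq_or_lt with rfl | ha'
    · simpa [show b = 1 by linarith] using hy.1 i
    · have h1 := mul_pos ha' (hx.1 i)
      have h2 := mul_nonneg hb (hy.1 i).le
      simpa using add_pos_of_pos_of_nonneg h1 h2
  · simp only [Pi.add_apply, Pi.smul_apply, smul_eq_mul, Finset.sum_add_distrib,
      ← Finset.mul_sum, hx.2, hy.2]
    linarith

theorem entropyGap_add (q : stdSimplex ℝ (Fin n)) (p r s : Fin n → ℝ) :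
    entropyGap q p r + entropyGap q r s = entropyGap q p s := by
  simp only [entropyGap, ← Finset.sum_add_distrib]
  exact Finset.sum_congr rfl fun i _ => by ring

/-- Jensen's inequality for the weights `q`. -/
theorem exp_entropyGap_le (q : stdSimplex ℝ (Fin n)) {p r : Fin n → ℝ} (hp : ∀ i, 0 < p i)
    (hr : ∀ i, 0 < r i) : Real.exp (entropyGap q p r) ≤ ∑ i, q.1 i * (r i / p i) := by
  have h := convexOn_exp.map_sum_le (t := Finset.univ) (w := q.1)
    (p := fun i => Real.log (r i) - Real.log (p i)) (fun i _ => q.2.1 i) q.2.2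
    (fun i _ => Set.mem_univ _)
  simpa [entropyGap, Real.exp_sub, Real.exp_log, hp, hr] using h

/-- A weighted geometric mean is concave: seen from `w = a x + b y`, Jensen bounds it by the linear
function `∑ i, q i * (r i / w i)` of `r`, which equals `1` at `w`. -/
theorem concaveOn_exp_entropyGap (q : stdSimplex ℝ (Fin n)) (p : Fin n → ℝ) :
    ConcaveOn ℝ (openSimplex n) fun r => Real.exp (entropyGap q p r) := by
  refine ⟨convex_openSimplex, fun x hx y hy a b ha hb hab => ?_⟩
  have hw := convex_openSimplex hx hy ha hb hab
  set w := a • x + b • y with hwdef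
  simp only [smul_eq_mul]
  rw [← entropyGap_add q p w x, ← entropyGap_add q p w y, Real.exp_add, Real.exp_add]
  have hX := mul_le_mul_of_nonneg_left (exp_entropyGap_le q hw.1 hx.1) ha
  have hY := mul_le_mul_of_nonneg_left (exp_entropyGap_le q hw.1 hy.1) hb
  have h1 : a * ∑ i, q.1 i * (x i / w i) + b * ∑ i, q.1 i * (y i / w i) = 1 := by
    rw [Finset.mul_sum, Finset.mul_sum, ← Finset.sum_add_distrib, ← q.2.2]
    refine Finset.sum_congr rfl fun i _ => ?_
    have hwi : w i = a * x i + b * y i := by simp [hwdef]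
    have : w i ≠ 0 := (hw.1 i).ne'
    field_simp
    rw [hwi]
  have h2 := mul_le_mul_of_nonneg_left ((add_le_add hX hY).trans h1.le)
    (Real.exp_pos (entropyGap q p w)).le
  linarith

/-- A cyclically monotone family of pairs has a potential `φ` with `exp φ` concave. -/
theorem exists_concave_potential {Z : Type*} [Nonempty Z] (p : Z → Fin n → ℝ)
    (q : Z → stdSimplex ℝ (Fin n))
    (hcyc : ∀ (m : ℕ) (z : Fin (m + 1) → Z),
      0 ≤ ∑ k, entropyGap (q (z k)) (p (z k)) (p (z (finRotate (m + 1) k)))) :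
    ∃ φ : (Fin n → ℝ) → ℝ,
      ConcaveOn ℝ (openSimplex n) (fun r => Real.exp (φ r)) ∧
      (∀ z, ∀ r ∈ openSimplex n, φ r ≤ φ (p z) + entropyGap (q z) (p z) r) ∧
      ∀ r ∈ openSimplex n, ∀ s ∈ openSimplex n, ∀ γ : ℝ,
        (∀ z, entropyGap (q z) r s ≤ γ) → φ s ≤ φ r + γ := by
  obtain ⟨u, hu⟩ := exists_potential (fun a b => entropyGap (q a) (p a) (p b)) hcyc
  have hbdd : ∀ r ∈ openSimplex n,
      BddBelow (Set.range fun z => u z + entropyGap (q z) (p z) r) := by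
    intro r hr
    let o : Z := Classical.arbitrary Z
    -- Every gap from `z` to `r` passes through `p o`: the potential controls the first leg, and
    -- weights `q i ≤ 1` the second, uniformly in `z`.
    refine ⟨u o - ∑ i, |Real.log (r i) - Real.log (p o i)|, ?_⟩
    rintro _ ⟨z, rfl⟩
    have h1 := hu z o
    have h2 : -(∑ i, |Real.log (r i) - Real.log (p o i)|) ≤ entropyGap (q z) (p o) r := by
      rw [entropyGap, ← Finset.sum_neg_distrib]
      refine Finset.sum_le_sum fun i _ => ?_
      have hq0 := (q z).2.1 i
      have hq1 : (q z).1 i ≤ 1 := by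
        rw [← (q z).2.2]
        exact Finset.single_le_sum (fun j _ => (q z).2.1 j) (Finset.mem_univ i)
      have h3 := neg_abs_le ((q z).1 i * (Real.log (r i) - Real.log (p o i)))
      rw [abs_mul, abs_of_nonneg hq0] at h3
      have h4 := mul_le_of_le_one_left (abs_nonneg (Real.log (r i) - Real.log (p o i))) hq1
      linarith
    simp only
    rw [← entropyGap_add (q z) (p z) (p o) r]
    linarith
  set φ : (Fin n → ℝ) → ℝ := fun r => ⨅ z, u z + entropyGap (q z) (p z) r with hφ
  have hle : ∀ r ∈ openSimplex n, ∀ z, φ r ≤ u z + entropyGap (q z) (p z) r :=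
    fun r hr z => ciInf_le (hbdd r hr) z
  have hφp : ∀ z, u z ≤ φ (p z) := fun z => le_ciInf fun z' => hu z' z
  refine ⟨φ, ⟨convex_openSimplex, fun x hx y hy a b ha hb hab => ?_⟩, fun z r hr => ?_,
    fun r hr s hs γ h => ?_⟩
  -- Taking logarithms lets the bound be tested on each member of the infimum defining `φ`.
  · have hpos : 0 < a • Real.exp (φ x) + b • Real.exp (φ y) :=
      (convex_Ioi (0 : ℝ)) (Real.exp_pos (φ x)) (Real.exp_pos (φ y)) ha hb hab
    rw [← Real.log_le_iff_le_exp hpos]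
    refine le_ciInf fun z => ?_
    rw [Real.log_le_iff_le_exp hpos, Real.exp_add]
    have hc := (concaveOn_exp_entropyGap (q z) (p z)).2 hx hy ha hb hab
    have hX := mul_le_mul_of_nonneg_left (Real.exp_le_exp.2 (hle x hx z)) ha
    have hY := mul_le_mul_of_nonneg_left (Real.exp_le_exp.2 (hle y hy z)) hb
    have hZ := mul_le_mul_of_nonneg_left hc (Real.exp_pos (u z)).le
    rw [Real.exp_add] at hX hY
    simp only [smul_eq_mul] at hZ ⊢
    linarith
  · linarith [hle r hr z, hφp z]
  · rw [← sub_le_iff_le_add]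
    refine le_ciInf fun z => ?_
    have := hle s hs z
    rw [← entropyGap_add (q z) (p z) r s] at this
    linarith [h z]

/-- The gradient of `log ∑ q i * r i / p i` gives supergradients of the potential. -/
theorem mem_superdifferential_of_le_entropyGap {φ : (Fin n → ℝ) → ℝ} {p : Fin n → ℝ}
    (hn : n ≠ 0) (hp : p ∈ openSimplex n) {q : stdSimplex ℝ (Fin n)}
    (h : ∀ r ∈ openSimplex n, φ r ≤ φ p + entropyGap q p r) :
    (fun i => q.1 i / p i - 1 / (n : ℝ) * ∑ j, q.1 j / p j) ∈ superdifferential φ p := by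
  have hn' : (n : ℝ) ≠ 0 := Nat.cast_ne_zero.2 hn
  refine ⟨?_, fun r hr => (h r hr).trans (add_le_add le_rfl ?_)⟩
  · simp only [Finset.sum_sub_distrib, Finset.sum_const, Finset.card_univ, Fintype.card_fin,
      nsmul_eq_mul]
    field_simp
    ring
  · have h1 : ∑ i, (q.1 i / p i - 1 / (n : ℝ) * ∑ j, q.1 j / p j) * (r i - p i) =
        ∑ i, q.1 i / p i * (r i - p i) := by
      simp only [sub_mul, Finset.sum_sub_distrib, ← Finset.mul_sum, hr.2, hp.2]
      ring
    rw [h1, entropyGap]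
    refine Finset.sum_le_sum fun i _ => ?_
    have h2 := Real.log_le_sub_one_of_pos (div_pos (hr.1 i) (hp.1 i))
    rw [Real.log_div (hr.1 i).ne' (hp.1 i).ne'] at h2
    have h3 : q.1 i / p i * (r i - p i) = q.1 i * (r i / p i - 1) := by
      have := (hp.1 i).ne'
      field_simp
    rw [h3]
    exact mul_le_mul_of_nonneg_left h2 (q.2.1 i)

end Entropy

/-! ### The transport problem -/

theorem ae_of_mem_couplings {X Y : Type*} [MeasurableSpace X] [MeasurableSpace Y]
    {P : Measure X} {Q : Measure Y} {R : Measure (X × Y)} (hR : R ∈ couplings P Q)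
    {U : Set X} {V : Set Y} (hP : ∀ᵐ p ∂P, p ∈ U) (hQ : ∀ᵐ q ∂Q, q ∈ V) :
    ∀ᵐ z ∂ R, z.1 ∈ U ∧ z.2 ∈ V := by
  rw [← hR.2.1] at hP
  rw [← hR.2.2] at hQ
  filter_upwards [ae_of_ae_map measurable_fst.aemeasurable hP,
    ae_of_ae_map measurable_snd.aemeasurable hQ] with z h1 h2 using ⟨h1, h2⟩

/-- The expectation of a cost that is almost surely the negative of a nonnegative function. -/
theorem expectation_eq_neg_integral {Ω : Type*} [MeasurableSpace Ω] {R : Measure Ω}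
    {c : Ω → EReal} {f : Ω → ℝ} (hf : Integrable f R) (hf0 : ∀ z, 0 ≤ f z)
    (h : ∀ᵐ z ∂ R, c z = -(f z : EReal)) :
    expectation R c = ((-∫ z, f z ∂ R : ℝ) : EReal) := by
  have h1 : ∫⁻ z, (c z).toENNReal ∂ R = 0 := by
    rw [lintegral_congr_ae (g := fun _ => 0), lintegral_zero]
    filter_upwards [h] with z hz
    rw [hz, ← EReal.coe_neg]
    exact EReal.toENNReal_of_nonpos (by exact_mod_cast neg_nonpos.2 (hf0 z))
  have h2 : ∫⁻ z, (-(c z)).toENNReal ∂ R = ENNReal.ofReal (∫ z, f z ∂ R) := by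
    rw [ofReal_integral_eq_lintegral_ofReal hf (.of_forall hf0)]
    refine lintegral_congr_ae ?_
    filter_upwards [h] with z hz
    rw [hz, neg_neg, EReal.toENNReal_of_ne_top (EReal.coe_ne_top _), EReal.toReal_coe]
  rw [expectation, h1, h2, EReal.coe_ennreal_ofReal, max_eq_left (integral_nonneg hf0)]
  simp

theorem theorem14 (n : ℕ) (hn : 2 ≤ n)
    (U V : Set (stdSimplex ℝ (Fin n))) (hU : ∀ p ∈ U, p.1 ∈ openSimplex n)
    (P Q : Measure (stdSimplex ℝ (Fin n))) [IsProbabilityMeasure P] [IsProbabilityMeasure Q]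
    (hP : ∀ᵐ p ∂P, p ∈ U) (hQ : ∀ᵐ q ∂Q, q ∈ V)
    (γ : ℝ) (hγ : (⨆ π ∈ V, ⨆ μ ∈ U, relativeEntropy π μ) = (γ : EReal)) :
    (∃ v : ℝ, transportValue entropyCost P Q = (v : EReal)) ∧
    ∃ Φ : (Fin n → ℝ) → ℝ,
      ConcaveOn ℝ (openSimplex n) Φ ∧
      (∀ p ∈ openSimplex n, 0 < Φ p) ∧
      (∀ R : Measure (stdSimplex ℝ (Fin n) × stdSimplex ℝ (Fin n)),
        IsOptimalCoupling entropyCost P Q R →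
        ∀ᵐ z ∂ R, z.1 ∈ U ∧
          (fun i => z.2.1 i / z.1.1 i - 1 / (n : ℝ) * ∑ j, z.2.1 j / z.1.1 j) ∈
            superdifferential (fun p => Real.log (Φ p)) z.1.1) ∧
      (∀ p ∈ U, ∀ q ∈ U, Φ q.1 / Φ p.1 ≤ Real.exp γ) ∧
      (∃ C : ℝ, ∀ p ∈ U, |Real.log (Φ p.1)| ≤ C) := by
  have hkl : ∀ p ∈ U, ∀ q ∈ V, klSum (p, q) ≤ γ := by
    intro p hp q hq
    have h : relativeEntropy q p ≤ (γ : EReal) := by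
      rw [← hγ]
      exact le_iSup₂_of_le q hq (le_iSup₂_of_le p hp le_rfl)
    rw [relativeEntropy_eq_klSum (hU p hp)] at h
    exact_mod_cast h
  obtain ⟨p₀, hp₀⟩ := hP.exists
  obtain ⟨q₀, hq₀⟩ := hQ.exists
  have hγ0 : 0 ≤ γ := (klSum_nonneg (hU p₀ hp₀)).trans (hkl p₀ hp₀ q₀ hq₀)
  -- Truncation to `[0, γ]` makes the function bounded everywhere and changes nothing on `U × V`,
  -- where every coupling is concentrated.
  set f : stdSimplex ℝ (Fin n) × stdSimplex ℝ (Fin n) → ℝ := fun z => max 0 (min γ (klSum z))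
    with hf
  have hfm : Measurable f := measurable_const.max (measurable_const.min measurable_klSum)
  have hf0 : ∀ z, 0 ≤ f z := fun z => le_max_left _ _
  have hfγ : ∀ z, f z ≤ γ := fun z => max_le hγ0 (min_le_left _ _)
  have hfC : ∀ z, |f z| ≤ γ := fun z => by rw [abs_of_nonneg (hf0 z)]; exact hfγ z
  have hfkl : ∀ p ∈ U, ∀ q ∈ V, f (p, q) = klSum (p, q) := fun p hp q hq => by
    rw [hf]
    simp only
    rw [min_eq_right (hkl p hp q hq), max_eq_right (klSum_nonneg (hU p hp))]
  have hint : ∀ R ∈ couplings P Q, Integrable f R := fun R hR => by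
    have := hR.1
    exact Integrable.of_bound hfm.aestronglyMeasurable γ (.of_forall hfC)
  have hexp : ∀ R ∈ couplings P Q,
      expectation R (fun z => entropyCost z.1 z.2) = ((-∫ z, f z ∂ R : ℝ) : EReal) := by
    intro R hR
    refine expectation_eq_neg_integral (hint R hR) hf0 ?_
    filter_upwards [ae_of_mem_couplings hR hP hQ] with z hz
    rw [entropyCost, relativeEntropy_eq_klSum (hU _ hz.1), ← hfkl _ hz.1 _ hz.2]
  have hval : ∃ v : ℝ, transportValue entropyCost P Q = (v : EReal) := by
    have hprod : P.prod Q ∈ couplings P Q :=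
      ⟨inferInstance, Measure.fst_prod, Measure.snd_prod⟩
    have h1 : transportValue entropyCost P Q ≤ ((-∫ z, f z ∂(P.prod Q) : ℝ) : EReal) := by
      rw [← hexp _ hprod]
      exact iInf₂_le _ hprod
    have h2 : ((-γ : ℝ) : EReal) ≤ transportValue entropyCost P Q := by
      refine le_iInf₂ fun R hR => ?_
      rw [hexp R hR, EReal.coe_le_coe_iff, neg_le_neg_iff]
      have := hR.1
      simpa using integral_mono (hint R hR) (integrable_const γ) hfγ
    exact ⟨_, (EReal.coe_toReal (h1.trans_lt (EReal.coe_lt_top _)).ne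
      ((EReal.bot_lt_coe _).trans_le h2).ne').symm⟩
  refine ⟨hval, ?_⟩
  have hmax : ∀ R, IsOptimalCoupling entropyCost P Q R → ∀ R' ∈ couplings P Q,
      ∫ z, f z ∂ R' ≤ ∫ z, f z ∂ R := by
    intro R hR R' hR'
    have h : expectation R (fun z => entropyCost z.1 z.2) ≤
        expectation R' (fun z => entropyCost z.1 z.2) := by
      rw [hR.2]
      exact iInf₂_le _ hR'
    rw [hexp R hR.1, hexp R' hR', EReal.coe_le_coe_iff, neg_le_neg_iff] at h
    exact h
  -- All optimal couplings enter at once, so that one `Φ` serves them all.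
  set Γ : Set (stdSimplex ℝ (Fin n) × stdSimplex ℝ (Fin n)) :=
    {z | (z.1 ∈ U ∧ z.2 ∈ V) ∧ ∃ R, IsOptimalCoupling entropyCost P Q R ∧ z ∈ R.support}
  have hΓae : ∀ R, IsOptimalCoupling entropyCost P Q R → ∀ᵐ z ∂ R, z ∈ Γ := by
    intro R hR
    filter_upwards [ae_of_mem_couplings hR.1 hP hQ, Measure.support_mem_ae] with z h1 h2
      using ⟨h1, R, hR, h2⟩
  -- If `Γ` is empty there is no optimal coupling, and a constant `Φ` suffices.
  rcases Γ.eq_empty_or_nonempty with hemp | hne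
  · refine ⟨fun _ => 1, concaveOn_const _ convex_openSimplex, fun _ _ => one_pos,
      fun R hR => ?_, fun _ _ _ _ => ?_, 0, fun _ _ => by simp⟩
    · filter_upwards [hΓae R hR] with z hz
      simp [hemp] at hz
    · simpa using hγ0
  have : Nonempty Γ := hne.to_subtype
  have hcyc : ∀ (m : ℕ) (z : Fin (m + 1) → Γ),
      0 ≤ ∑ k, entropyGap (z k).1.2 (z k).1.1.1 (z (finRotate (m + 1) k)).1.1.1 := by
    intro m z
    choose R hR hz using fun k => (z k).2.2
    have hzU : ∀ k, (z k).1.1 ∈ U := fun k => (z k).2.1.1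
    have hzV : ∀ k, (z k).1.2 ∈ V := fun k => (z k).2.1.2
    have h := cyclicallyMonotone_of_maximal hfm hfC (finRotate (m + 1)) (fun k => (hR k).1)
      (fun k => hmax _ (hR k)) (z := fun k => (z k).1) hz (fun k l =>
        continuousAt_const.max (continuousAt_const.min (continuousAt_klSum (hU _ (hzU k)))))
    have h1 : ∀ k, entropyGap (z k).1.2 (z k).1.1.1 (z (finRotate (m + 1) k)).1.1.1 =
        f (z k).1 - f ((z (finRotate (m + 1) k)).1.1, (z k).1.2) := by
      intro k
      rw [← klSum_sub_klSum (hU _ (hzU _)) (hU _ (hzU _)), ← hfkl _ (hzU k) _ (hzV k),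
        ← hfkl _ (hzU (finRotate (m + 1) k)) _ (hzV k)]
    simp only [h1, Finset.sum_sub_distrib]
    linarith
  obtain ⟨φ, hconc, hsup, hbd⟩ := exists_concave_potential (fun z : Γ => z.1.1.1)
    (fun z : Γ => z.1.2) hcyc
  -- The gap is `H(π | p) - H(π | q) ≤ γ - 0` for every `π ∈ V`, whichever pair of `Γ` it comes
  -- from.
  have hosc : ∀ p ∈ U, ∀ q ∈ U, φ q.1 ≤ φ p.1 + γ := by
    intro p hp q hq
    refine hbd _ (hU p hp) _ (hU q hq) γ fun z => ?_
    rw [← klSum_sub_klSum (hU p hp) (hU q hq)]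
    linarith [hkl p hp _ z.2.1.2, klSum_nonneg (q := z.1.2) (hU q hq)]
  refine ⟨fun r => Real.exp (φ r), hconc, fun _ _ => Real.exp_pos _, fun R hR => ?_,
    fun p hp q hq => ?_, |φ p₀.1| + γ, fun p hp => ?_⟩
  · filter_upwards [hΓae R hR] with z hz
    simp only [Real.log_exp]
    exact ⟨hz.1.1, mem_superdifferential_of_le_entropyGap (by omega) (hU _ hz.1.1)
      (hsup ⟨z, hz⟩)⟩
  · rw [← Real.exp_sub, Real.exp_le_exp]
    linarith [hosc p hp q hq]
  · rw [Real.log_exp, abs_le]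
    have h1 := hosc p hp p₀ hp₀
    have h2 := hosc p₀ hp₀ p hp
    constructor
    · linarith [neg_abs_le (φ p₀.1)]
    · linarith [le_abs_self (φ p₀.1)]
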